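/- Let $\sigma(n)$ be the sum of the positive divisors of $n$, $\varphi$ Euler's totient function and $\gamma$ Euler's constant. For every real $t$ the limits $$A(t)=\lim_{N\to\infty}\frac1N\left|\{1\le n\le N:\ \sigma(n)/n\ge t\}\right|,\qquad B(t)=\lim_{N\to\infty}\frac1N\left|\{1\le n\le N:\ n/\varphi(n)\ge t\}\right|$$ exist. Moreover, there is a constant $t_0$ such that for all real $t\ge t_0$, with $y=y(t)=e^{t e^{-\gamma}}$, $$A(t)\le B(t)<e^{3\sqrt y}\,A\!\left(t-\frac{5e^{\gamma}}{\sqrt y}\right).$$ -/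

import Mathlib

noncomputable section

/-- The proportion of the integers `1 ≤ n ≤ N` with `f n ≥ t`. -/
def propGE (f : ℕ → ℝ) (t : ℝ) (N : ℕ) : ℝ :=
  (((Finset.Icc 1 N).filter (fun n => t ≤ f n)).card : ℝ) / (N : ℝ)

/-- The ratio `σ(n)/n`, where `σ(n)` is the sum of the positive divisors of `n`. -/
def sigmaRatio (n : ℕ) : ℝ :=
  (ArithmeticFunction.sigma 1 n : ℝ) / (n : ℝ)

/-- The ratio `n/φ(n)`, where `φ` is Euler's totient function. -/
def totientRatio (n : ℕ) : ℝ :=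
  (n : ℝ) / (Nat.totient n : ℝ)

/-- `A(t)`: the limit, as `N → ∞`, of the proportion of `n ≤ N` with `σ(n)/n ≥ t`. -/
def distA (t : ℝ) : ℝ :=
  Filter.limUnder Filter.atTop (fun N : ℕ => propGE sigmaRatio t N)

/-- `B(t)`: the limit, as `N → ∞`, of the proportion of `n ≤ N` with `n/φ(n) ≥ t`. -/
def distB (t : ℝ) : ℝ :=
  Filter.limUnder Filter.atTop (fun N : ℕ => propGE totientRatio t N)

/-- `y(t) = exp(t e^{-γ})`, with `γ` Euler's constant. -/
def yParam (t : ℝ) : ℝ :=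
  Real.exp (t * Real.exp (-Real.eulerMascheroniConstant))

end

/-!
Both ratios are divisor sums `f n = ∑_{d ∣ n} g d` with `g ≥ 0` and `∑ g(d)/d < ∞`: `g d = 1/d` for
`σ(n)/n` and `g d = μ²(d)/φ(d)` for `n/φ(n)`. Cutting the sum at `d ≤ K` gives a function periodic
modulo `K!`, whose superlevel sets have densities, and the error made is small on average. So the
densities of `{n : f n ≥ t}` exist provided that `f` rarely takes values just above `t`. That holds
because `n ↦ n / p`, with `p ∥ n` taken from a fixed finite set of primes, is injective on the `n`
whose values lie in a short enough window (`card_filter_window_le`, `exists_tendsto_propGE`).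

The inequality `A ≤ B` is `σ(n)/n ≤ n/φ(n)`. For the other one, let `z = √y`, so that
`t = 2 e^γ log z`. The two ratios have Euler factors `(1 - p^{-a-1})/(1 - 1/p)`, where `p^a ∥ n`,
and `1/(1 - 1/p)`. Multiplying `n` by a fixed `Q` in which the primes up to about `2z` occur once and
the much smaller ones to a high power makes the factors `1 - p^{-a-1}` harmless: by Chebyshev's bound
`θ(x) ≤ x log 4`, their product is at least `1 - 5/(2 z log z)`, while `Q < e^{3z}`
(`eventually_exists_multiplier`). Hence `n/φ(n) ≥ t` implies `σ(Qn)/(Qn) ≥ t - 5 e^γ / z`, and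
passing to densities, `B(t)/Q ≤ A(t - 5 e^γ / z)`.
-/

section

open Finset Filter Topology


/-! ### Existence of densities -/

/-- A periodic set has a density, with a bounded error. -/
theorem abs_card_filter_periodic_sub_le {M : ℕ} (hM : 0 < M) (p : ℕ → Prop) [DecidablePred p]
    (hp : Function.Periodic p M) (N : ℕ) :
    |(((Icc 1 N).filter p).card : ℝ) - N * ((M.count p : ℝ) / M)| ≤ M := by
  have hM' : (0 : ℝ) < M := by exact_mod_cast hM
  induction N using Nat.strong_induction_on with
  | _ N ih =>
    rcases lt_or_ge N M with h | h
    · have h1 : (((Icc 1 N).filter p).card : ℝ) ≤ N := by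
        exact_mod_cast (card_filter_le _ _).trans (by simp)
      have h2 : (M.count p : ℝ) / M ≤ 1 := by
        rw [div_le_one hM']
        exact_mod_cast Nat.count_le p
      have h3 : (0 : ℝ) ≤ (M.count p : ℝ) / M := by positivity
      have h4 : (N : ℝ) ≤ M := by exact_mod_cast h.le
      have h5 : (N : ℝ) * ((M.count p : ℝ) / M) ≤ N := mul_le_of_le_one_right (by positivity) h2
      have h6 : (0 : ℝ) ≤ (N : ℝ) * ((M.count p : ℝ) / M) := by positivity
      rw [abs_le]
      constructor <;> linarith [(Nat.cast_nonneg _ : (0 : ℝ) ≤ (((Icc 1 N).filter p).card : ℝ))]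
    · obtain ⟨k, rfl⟩ := Nat.exists_eq_add_of_le' h
      have hsplit : Icc 1 (k + M) = Icc 1 k ∪ Ico (k + 1) (k + 1 + M) := by
        ext x; simp only [mem_union, mem_Icc, mem_Ico]; omega
      have hdisj : Disjoint (Icc 1 k) (Ico (k + 1) (k + 1 + M)) := by
        rw [disjoint_left]; intro x; simp only [mem_Icc, mem_Ico]; omega
      rw [hsplit, filter_union, card_union_of_disjoint (disjoint_filter_filter hdisj),
        Nat.filter_Ico_card_eq_of_periodic _ _ _ hp]
      have := ih k (by omega)
      convert this using 2
      push_cast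
      field_simp
      ring

theorem card_filter_dvd_le (N d : ℕ) :
    (((Icc 1 N).filter (d ∣ ·)).card : ℝ) ≤ N / d := by
  have : (Icc 1 N).filter (d ∣ ·) = (Ioc 0 N).filter (d ∣ ·) := by
    ext x; simp only [mem_filter, mem_Icc, mem_Ioc]; omega
  rw [this, Nat.Ioc_filter_dvd_card_eq_div]
  exact Nat.cast_div_le

theorem exists_primes_prod_one_sub_inv_le (X : ℕ) {η : ℝ} (hη : 0 < η) :
    ∃ P : Finset ℕ, (∀ p ∈ P, p.Prime ∧ X < p) ∧ ∏ p ∈ P, (1 - (p : ℝ)⁻¹) ≤ η := by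
  have hdiv := (not_summable_iff_tendsto_nat_atTop_of_nonneg (fun n => by
    by_cases h : n ∈ {p : ℕ | p.Prime} <;> simp [h])).1 not_summable_one_div_on_primes
  obtain ⟨n, hn⟩ := (hdiv.eventually_ge_atTop (X + 1 - Real.log η)).exists
  refine ⟨(range n).filter (fun p => p.Prime ∧ X < p), fun p hp => (mem_filter.1 hp).2, ?_⟩
  have h1 : ∏ p ∈ (range n).filter (fun p => p.Prime ∧ X < p), (1 - (p : ℝ)⁻¹) ≤
      Real.exp (-∑ p ∈ (range n).filter (fun p => p.Prime ∧ X < p), (p : ℝ)⁻¹) := by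
    rw [← sum_neg_distrib, Real.exp_sum]
    refine prod_le_prod (fun p hp => ?_) (fun p _ => Real.one_sub_le_exp_neg _)
    have : (1 : ℝ) ≤ p := by exact_mod_cast (mem_filter.1 hp).2.1.one_le
    linarith [inv_le_one_of_one_le₀ this]
  refine h1.trans ?_
  rw [← Real.le_log_iff_exp_le hη]
  have h2 : ∑ k ∈ range n, Set.indicator {p : ℕ | p.Prime} (fun n : ℕ => (1 : ℝ) / n) k ≤
      ∑ p ∈ (range n).filter (fun p => p.Prime ∧ X < p), (p : ℝ)⁻¹ +
        ∑ k ∈ (range n).filter (· ≤ X), (1 : ℝ) := by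
    rw [sum_filter, sum_filter, ← sum_add_distrib]
    refine sum_le_sum fun k _ => ?_
    have hk : (k : ℝ)⁻¹ ≤ 1 := Nat.cast_inv_le_one k
    have hk' : (0 : ℝ) ≤ (k : ℝ)⁻¹ := by positivity
    by_cases hp : k.Prime <;> rcases le_or_gt k X with hX | hX <;>
      simp [hp, hX, hk, not_le.2, not_lt.2]
  have h3 : ∑ k ∈ (range n).filter (· ≤ X), (1 : ℝ) ≤ X + 1 := by
    rw [sum_const, nsmul_eq_mul, mul_one]
    have : (range n).filter (· ≤ X) ⊆ range (X + 1) := by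
      intro k; simp only [mem_filter, mem_range]; omega
    have := card_le_card this
    rw [card_range] at this
    exact_mod_cast this
  linarith

theorem sum_inv_sq_le {X : ℕ} (hX : 0 < X) {P : Finset ℕ} (hP : ∀ p ∈ P, X < p) :
    ∑ p ∈ P, ((p : ℝ) ^ 2)⁻¹ ≤ (X : ℝ)⁻¹ := by
  have hsub : P ⊆ Ioc X (X + P.sup id) := fun p hp =>
    mem_Ioc.2 ⟨hP p hp, (le_sup (f := id) hp).trans (Nat.le_add_left _ _)⟩
  refine (sum_le_sum_of_subset_of_nonneg hsub fun _ _ _ => by positivity).trans ?_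
  refine (sum_Ioc_inv_sq_le_sub hX.ne' (Nat.le_add_right _ _)).trans ?_
  have : (0 : ℝ) ≤ ((X + P.sup id : ℕ) : ℝ)⁻¹ := by positivity
  linarith

theorem cast_totient_eq_mul_prod (n : ℕ) :
    (n.totient : ℝ) = n * ∏ p ∈ n.primeFactors, (1 - (p : ℝ)⁻¹) := by
  have := congrArg (Rat.cast (K := ℝ)) (Nat.totient_eq_mul_prod_factors n)
  push_cast at this
  exact this

/-- Few `n` have `f n` in a short window `[t, t + δ)`. Apart from the `n` prime to all `p ∈ P` and
the `n` divisible by the square of some `p ∈ P`, each `n` has a prime `p ∈ P` with `p ∥ n`, and the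
map `n ↦ n / p` into `[1, N / X]` is injective on the window: two `n` with the same image `m` have
values `c p * f m` and `c q * f m`, which are at least `δ` apart if `p ≠ q` because `f m ≥ 1`. -/
theorem card_filter_window_le {f c : ℕ → ℝ} (h1 : ∀ n, 0 < n → 1 ≤ f n)
    (hmul : ∀ p m : ℕ, p.Prime → 0 < m → ¬ p ∣ m → f (p * m) = c p * f m)
    {P : Finset ℕ} {X : ℕ} (hX : 0 < X) (hP : ∀ p ∈ P, p.Prime ∧ X < p) {δ : ℝ}
    (hδ : ∀ p ∈ P, ∀ q ∈ P, p ≠ q → δ ≤ |c p - c q|) (t : ℝ) (N : ℕ) :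
    (((Icc 1 N).filter (fun n => t ≤ f n ∧ f n < t + δ)).card : ℝ) ≤
      N * (∏ p ∈ P, (1 - (p : ℝ)⁻¹) + 2 * (X : ℝ)⁻¹) + ∏ p ∈ P, p := by
  classical
  set Q := ∏ p ∈ P, p with hQ
  have hQ0 : 0 < Q := prod_pos fun p hp => (hP p hp).1.pos
  set E := (Icc 1 N).filter (fun n => t ≤ f n ∧ f n < t + δ) with hE
  set S := (Icc 1 N).filter (Q.Coprime ·) with hS
  set T := P.biUnion (fun p => (Icc 1 N).filter (p ^ 2 ∣ ·)) with hT
  set R := E.filter (fun n => ∃ p ∈ P, p ∣ n ∧ ¬ p ^ 2 ∣ n) with hR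
  have hcover : E ⊆ S ∪ T ∪ R := by
    intro n hn
    have hn' := (mem_filter.1 hn).1
    simp only [mem_union, hS, hT, hR, mem_filter, mem_biUnion]
    by_cases hco : Q.Coprime n
    · exact Or.inl (Or.inl ⟨hn', hco⟩)
    · rw [hQ, Nat.coprime_prod_left_iff] at hco
      push Not at hco
      obtain ⟨p, hp, hpn⟩ := hco
      have hpn : p ∣ n := by
        by_contra h; exact hpn (((hP p hp).1.coprime_iff_not_dvd).2 h)
      by_cases h2 : p ^ 2 ∣ n
      · exact Or.inl (Or.inr ⟨p, hp, hn', h2⟩)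
      · exact Or.inr ⟨hn, p, hp, hpn, h2⟩
  have hScard : (S.card : ℝ) ≤ N * ∏ p ∈ P, (1 - (p : ℝ)⁻¹) + Q := by
    have h := abs_card_filter_periodic_sub_le hQ0 (Q.Coprime ·) (Nat.periodic_coprime Q) N
    have hφ : ((Q.count (Q.Coprime ·) : ℕ) : ℝ) / Q = ∏ p ∈ P, (1 - (p : ℝ)⁻¹) := by
      have hc : Q.count (Q.Coprime ·) = Q.totient := by
        rw [Nat.count_eq_card_filter_range]; rfl
      have hpf : Q.primeFactors = P := Nat.primeFactors_prod fun p hp => (hP p hp).1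
      have h' := cast_totient_eq_mul_prod Q
      rw [hpf] at h'
      rw [hc, h', mul_div_cancel_left₀]
      positivity
    rw [hφ] at h
    linarith [(abs_le.1 h).2]
  have hTcard : (T.card : ℝ) ≤ N * (X : ℝ)⁻¹ := by
    calc (T.card : ℝ) ≤ ∑ p ∈ P, (((Icc 1 N).filter (p ^ 2 ∣ ·)).card : ℝ) := by
          exact_mod_cast card_biUnion_le
      _ ≤ ∑ p ∈ P, (N : ℝ) * ((p : ℝ) ^ 2)⁻¹ := sum_le_sum fun p _ => by
          have := card_filter_dvd_le N (p ^ 2)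
          push_cast at this
          rwa [div_eq_mul_inv] at this
      _ = N * ∑ p ∈ P, ((p : ℝ) ^ 2)⁻¹ := by rw [mul_sum]
      _ ≤ _ := by
          gcongr
          exact sum_inv_sq_le hX fun p hp => (hP p hp).2
  have hRcard : (R.card : ℝ) ≤ N * (X : ℝ)⁻¹ := by
    have hex : ∀ n : ℕ, ∃ p : ℕ, n ∈ R → p ∈ P ∧ p ∣ n ∧ ¬ p ^ 2 ∣ n := fun n => by
      by_cases h : n ∈ R
      · obtain ⟨p, hp⟩ := (mem_filter.1 h).2
        exact ⟨p, fun _ => hp⟩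
      · exact ⟨0, fun h' => absurd h' h⟩
    choose π hπ using hex
    have hfac : ∀ n ∈ R, π n * (n / π n) = n ∧ 0 < n / π n ∧ ¬ π n ∣ n / π n := by
      intro n hn
      obtain ⟨hp, hd, hnd⟩ := hπ n hn
      have hn0 : 0 < n := (mem_Icc.1 (mem_filter.1 (mem_filter.1 hn).1).1).1
      have he := Nat.mul_div_cancel' hd
      refine ⟨he, Nat.div_pos (Nat.le_of_dvd hn0 hd) (hP _ hp).1.pos, fun h => hnd ?_⟩
      have := mul_dvd_mul_left (π n) h
      rwa [he, ← sq] at this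
    have hle : R.card ≤ (Icc 1 (N / X)).card := by
      refine card_le_card_of_injOn (fun n => n / π n) (fun n hn => ?_) (fun n hn n' hn' he => ?_)
      · have hn : n ∈ R := hn
        have hnN : n ≤ N := (mem_Icc.1 (mem_filter.1 (mem_filter.1 hn).1).1).2
        have hXp := (hP _ (hπ n hn).1).2
        exact mem_coe.2 (mem_Icc.2 ⟨(hfac n hn).2.1, Nat.div_le_div hnN hXp.le hX.ne'⟩)
      · have hn : n ∈ R := hn
        have hn' : n' ∈ R := hn'
        simp only at he
        obtain ⟨e1, m0, d1⟩ := hfac n hn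
        obtain ⟨e2, -, d2⟩ := hfac n' hn'
        rw [← he] at e2 d2
        obtain ⟨-, a1, b1⟩ := mem_filter.1 (mem_filter.1 hn).1
        obtain ⟨-, a2, b2⟩ := mem_filter.1 (mem_filter.1 hn').1
        have f1 := hmul _ _ (hP _ (hπ n hn).1).1 m0 d1
        have f2 := hmul _ _ (hP _ (hπ n' hn').1).1 m0 d2
        rw [e1] at f1
        rw [e2] at f2
        by_cases hpq : π n = π n'
        · rw [← e1, ← e2, hpq]
        · exfalso
          have hsep := hδ _ (hπ n hn).1 _ (hπ n' hn').1 hpq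
          have hm := h1 _ m0
          have hdiff : |c (π n) - c (π n')| * f (n / π n) < δ := by
            rw [← abs_of_pos (zero_lt_one.trans_le hm), ← abs_mul, sub_mul, ← f1, ← f2, abs_lt]
            constructor <;> linarith
          nlinarith [abs_nonneg (c (π n) - c (π n'))]
    calc (R.card : ℝ) ≤ ((N / X : ℕ) : ℝ) := by
          have := hle; rw [Nat.card_Icc, Nat.add_sub_cancel] at this; exact_mod_cast this
      _ ≤ N / X := Nat.cast_div_le
      _ = _ := div_eq_mul_inv _ _
  have h4 : (E.card : ℝ) ≤ S.card + T.card + R.card := by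
    exact_mod_cast (card_le_card hcover).trans
      ((card_union_le _ _).trans (Nat.add_le_add_right (card_union_le _ _) _))
  have : ((∏ p ∈ P, p : ℕ) : ℝ) = Q := by rw [hQ]
  linarith

/-- The values of `f` have no concentration: windows of a suitable length `δ > 0` contain `f n` for
a proportion at most `η` of the `n`, up to a bounded number `C`, uniformly in the window. -/
theorem exists_window {f c : ℕ → ℝ} (h1 : ∀ n, 0 < n → 1 ≤ f n)
    (hmul : ∀ p m : ℕ, p.Prime → 0 < m → ¬ p ∣ m → f (p * m) = c p * f m)
    (hc : Set.InjOn c {p | p.Prime}) {η : ℝ} (hη : 0 < η) :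
    ∃ δ > 0, ∃ C : ℝ, ∀ (t : ℝ) (N : ℕ),
      (((Icc 1 N).filter (fun n => t ≤ f n ∧ f n < t + δ)).card : ℝ) ≤ η * N + C := by
  obtain ⟨X, hX⟩ := exists_nat_gt (4 / η)
  have hX0' : (0 : ℝ) < X := lt_trans (by positivity) hX
  have hX0 : 0 < X := by exact_mod_cast hX0'
  obtain ⟨P, hP, hprod⟩ := exists_primes_prod_one_sub_inv_le X (half_pos hη)
  have hδ : ∃ δ > 0, ∀ x ∈ P.offDiag, δ ≤ |c x.1 - c x.2| := by
    rcases P.offDiag.eq_empty_or_nonempty with h | h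
    · exact ⟨1, one_pos, by simp [h]⟩
    · refine ⟨P.offDiag.inf' h (fun x => |c x.1 - c x.2|), ?_, fun x hx => inf'_le _ hx⟩
      rw [gt_iff_lt, lt_inf'_iff]
      intro x hx
      rw [mem_offDiag] at hx
      exact abs_pos.2 (sub_ne_zero.2 fun h => hx.2.2 (hc (hP _ hx.1).1 (hP _ hx.2.1).1 h))
  obtain ⟨δ, hδ0, hδ⟩ := hδ
  refine ⟨δ, hδ0, (∏ p ∈ P, p : ℕ), fun t N => ?_⟩
  refine (card_filter_window_le h1 hmul hX0 hP
    (fun p hp q hq h => hδ (p, q) (mem_offDiag.2 ⟨hp, hq, h⟩)) t N).trans ?_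
  have hX1 : 2 * (X : ℝ)⁻¹ ≤ η / 2 := by
    rw [← div_eq_mul_inv, div_le_iff₀ hX0']
    rw [div_lt_iff₀ hη] at hX
    linarith
  rw [mul_comm η]
  gcongr
  linarith

/-- The density of `{n : f n ≥ t}` exists if `f = 1 * g` with `g ≥ 0` and `∑ g(d)/d < ∞`, and if `f`
is scaled by distinct factors `c p` at distinct new primes. For the sum `F` of `g` over the divisors
up to `K`, the set `{n : F n ≥ t}` is periodic; it differs from `{n : f n ≥ t}` only where
`f - F ≥ δ`, which is rare by Markov's inequality, or where `f` lies in `[t, t + δ)`. -/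
theorem exists_tendsto_propGE {f g c : ℕ → ℝ} (hg : ∀ d, 0 ≤ g d) (hg1 : g 1 = 1)
    (hsum : Summable fun d : ℕ => g d / d)
    (hf : ∀ n, 0 < n → f n = ∑ d ∈ n.divisors, g d)
    (hmul : ∀ p m : ℕ, p.Prime → 0 < m → ¬ p ∣ m → f (p * m) = c p * f m)
    (hc : Set.InjOn c {p | p.Prime}) (t : ℝ) :
    ∃ l, Tendsto (fun N : ℕ => propGE f t N) atTop (𝓝 l) := by
  classical
  refine cauchySeq_tendsto_of_complete ?_
  have h1 : ∀ n, 0 < n → 1 ≤ f n := fun n hn => by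
    rw [hf n hn, ← hg1]
    exact single_le_sum (fun d _ => hg d) (Nat.one_mem_divisors.2 hn.ne')
  rw [Metric.cauchySeq_iff]
  intro ε hε
  obtain ⟨δ, hδ, C, hwin⟩ := exists_window h1 hmul hc (η := ε / 16) (by positivity)
  obtain ⟨K, hK⟩ : ∃ K : ℕ, ∀ s : Finset ℕ, (∀ d ∈ s, K < d) →
      ∑ d ∈ s, g d / d ≤ δ * (ε / 16) := by
    obtain ⟨u, hu⟩ := summable_iff_vanishing_norm.1 hsum (δ * (ε / 16)) (by positivity)
    refine ⟨u.sup id, fun s hs => ((le_abs_self _).trans (hu s ?_).le)⟩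
    rw [disjoint_left]
    exact fun d hd hd' => absurd (le_sup (f := id) hd') (not_le.2 (hs d hd))
  -- the truncated function is periodic modulo `K!`
  set F : ℕ → ℝ := fun n => ∑ d ∈ Icc 1 K, if d ∣ n then g d else 0 with hF
  have hFper : Function.Periodic (fun n => t ≤ F n) K.factorial := by
    intro n
    have : F (n + K.factorial) = F n := by
      refine sum_congr rfl fun d hd => ?_
      have hdK : d ∣ K.factorial := Nat.dvd_factorial (mem_Icc.1 hd).1 (mem_Icc.1 hd).2
      simp only [Nat.dvd_add_left hdK]
    simp only [this]
  have hsplit : ∀ n, 0 < n → f n = F n + ∑ d ∈ n.divisors.filter (K < ·), g d := by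
    intro n hn
    rw [hf n hn, ← sum_filter_not_add_sum_filter _ (K < ·)]
    congr 1
    rw [hF]
    simp only
    rw [← sum_filter]
    refine sum_congr ?_ fun _ _ => rfl
    ext d
    simp only [mem_filter, Nat.mem_divisors, mem_Icc, not_lt]
    constructor
    · rintro ⟨⟨a, _⟩, b⟩; exact ⟨⟨Nat.pos_of_dvd_of_pos a hn, b⟩, a⟩
    · rintro ⟨⟨_, b⟩, a⟩; exact ⟨⟨a, hn.ne'⟩, b⟩
  -- Markov's inequality for the tail of the divisor sum
  have htail : ∀ N : ℕ, (((Icc 1 N).filter fun n => δ ≤ f n - F n).card : ℝ) ≤ ε / 16 * N := by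
    intro N
    have hA : δ * ((Icc 1 N).filter fun n => δ ≤ f n - F n).card ≤
        ∑ n ∈ Icc 1 N, ∑ d ∈ n.divisors.filter (K < ·), g d := by
      calc δ * ((Icc 1 N).filter fun n => δ ≤ f n - F n).card
          = ∑ n ∈ (Icc 1 N).filter fun n => δ ≤ f n - F n, δ := by
            rw [sum_const, nsmul_eq_mul, mul_comm]
        _ ≤ ∑ n ∈ (Icc 1 N).filter fun n => δ ≤ f n - F n,
              ∑ d ∈ n.divisors.filter (K < ·), g d := sum_le_sum fun n hn => by
            obtain ⟨hn, h⟩ := mem_filter.1 hn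
            linarith [hsplit n (mem_Icc.1 hn).1]
        _ ≤ _ := sum_le_sum_of_subset_of_nonneg (filter_subset _ _)
            fun _ _ _ => sum_nonneg fun d _ => hg d
    have hB : ∑ n ∈ Icc 1 N, ∑ d ∈ n.divisors.filter (K < ·), g d =
        ∑ d ∈ Ioc K N, ∑ n ∈ (Icc 1 N).filter (d ∣ ·), g d := by
      refine sum_comm' fun n d => ?_
      simp only [mem_Icc, mem_filter, Nat.mem_divisors, mem_Ioc]
      constructor
      · rintro ⟨⟨a, b⟩, ⟨h, _⟩, k⟩
        exact ⟨⟨⟨a, b⟩, h⟩, k, (Nat.le_of_dvd a h).trans b⟩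
      · rintro ⟨⟨⟨a, b⟩, h⟩, k, _⟩
        exact ⟨⟨a, b⟩, ⟨h, by omega⟩, k⟩
    have hC : ∑ d ∈ Ioc K N, ∑ n ∈ (Icc 1 N).filter (d ∣ ·), g d ≤ N * (δ * (ε / 16)) := by
      calc _ ≤ ∑ d ∈ Ioc K N, N * (g d / d) := sum_le_sum fun d _ => by
            rw [sum_const, nsmul_eq_mul]
            refine (mul_le_mul_of_nonneg_right (card_filter_dvd_le N d) (hg d)).trans_eq ?_
            ring
        _ = N * ∑ d ∈ Ioc K N, g d / d := by rw [mul_sum]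
        _ ≤ _ := by
            gcongr
            exact hK _ fun d hd => (mem_Ioc.1 hd).1
    have := hA.trans (hB.trans_le hC)
    nlinarith
  have hcmp : ∀ N : ℕ, |(((Icc 1 N).filter fun n => t ≤ f n).card : ℝ) -
      ((Icc 1 N).filter fun n => t ≤ F n).card| ≤ ε / 8 * N + C := by
    intro N
    have hsub : (Icc 1 N).filter (fun n => t ≤ F n) ⊆ (Icc 1 N).filter fun n => t ≤ f n := by
      intro n hn
      obtain ⟨hn, h⟩ := mem_filter.1 hn
      refine mem_filter.2 ⟨hn, h.trans ?_⟩
      rw [hsplit n (mem_Icc.1 hn).1]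
      linarith [sum_nonneg fun d (_ : d ∈ n.divisors.filter (K < ·)) => hg d]
    have hsub' : (Icc 1 N).filter (fun n => t ≤ f n) ⊆ (Icc 1 N).filter (fun n => t ≤ F n) ∪
        (((Icc 1 N).filter fun n => δ ≤ f n - F n) ∪
          (Icc 1 N).filter fun n => t ≤ f n ∧ f n < t + δ) := by
      intro n hn
      obtain ⟨hn, h⟩ := mem_filter.1 hn
      simp only [mem_union, mem_filter, hn, true_and]
      by_contra! hcon
      linarith [hcon.2.2 h]
    have ha : (((Icc 1 N).filter fun n => t ≤ F n).card : ℝ) ≤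
        ((Icc 1 N).filter fun n => t ≤ f n).card := by exact_mod_cast card_le_card hsub
    have hb : (((Icc 1 N).filter fun n => t ≤ f n).card : ℝ) ≤
        ((Icc 1 N).filter fun n => t ≤ F n).card +
          (((Icc 1 N).filter fun n => δ ≤ f n - F n).card +
            ((Icc 1 N).filter fun n => t ≤ f n ∧ f n < t + δ).card) := by
      exact_mod_cast (card_le_card hsub').trans
        ((card_union_le _ _).trans (Nat.add_le_add_left (card_union_le _ _) _))
    rw [abs_of_nonneg (by linarith)]
    linarith [htail N, hwin t N]
  set κ : ℝ := (K.factorial.count (fun n => t ≤ F n) : ℝ) / K.factorial with hκ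
  have hlim : ∀ N : ℕ, |(((Icc 1 N).filter fun n => t ≤ f n).card : ℝ) - N * κ| ≤
      ε / 8 * N + (C + K.factorial) := by
    intro N
    have hp := abs_card_filter_periodic_sub_le K.factorial_pos _ hFper N
    refine (abs_sub_le _ _ _).trans ((add_le_add (hcmp N) hp).trans_eq (by ring))
  obtain ⟨N₀, hN₀⟩ := exists_nat_gt (max 1 ((C + K.factorial) / (ε / 8)))
  refine ⟨N₀, ?_⟩
  have key : ∀ N ≥ N₀, |propGE f t N - κ| ≤ ε / 4 := by
    intro N hN
    have hN' : max 1 ((C + K.factorial) / (ε / 8)) < (N : ℝ) :=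
      hN₀.trans_le (by exact_mod_cast hN)
    have hpos : (0 : ℝ) < N := zero_lt_one.trans ((le_max_left _ _).trans_lt hN')
    have hlarge := (div_lt_iff₀ (by positivity)).1 ((le_max_right _ _).trans_lt hN')
    have e : propGE f t N - κ = ((((Icc 1 N).filter fun n => t ≤ f n).card : ℝ) - N * κ) / N := by
      rw [propGE]; field_simp
    rw [e, abs_div, abs_of_pos hpos, div_le_iff₀ hpos]
    linarith [hlim N]
  intro m hm n hn
  rw [Real.dist_eq]
  have := abs_sub_le (propGE f t m) κ (propGE f t n)
  have hn' := key n hn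
  rw [abs_sub_comm] at hn'
  linarith [key m hm]


/-! ### The ratios `σ(n)/n` and `n/φ(n)` -/

theorem totientRatio_eq_prod {n : ℕ} (hn : n ≠ 0) :
    totientRatio n = ∏ p ∈ n.primeFactors, (1 - (p : ℝ)⁻¹)⁻¹ := by
  have hn' : (n : ℝ) ≠ 0 := by exact_mod_cast hn
  rw [totientRatio, cast_totient_eq_mul_prod, prod_inv_distrib, div_mul_eq_div_div, div_self hn',
    one_div]

theorem sigmaRatio_eq_sum (n : ℕ) : sigmaRatio n = ∑ d ∈ n.divisors, (d : ℝ)⁻¹ := by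
  rw [sigmaRatio, ← Nat.sum_div_divisors n (fun d => (d : ℝ)⁻¹), ArithmeticFunction.sigma_one_apply,
    Nat.cast_sum, sum_div]
  refine sum_congr rfl fun d hd => ?_
  rw [Nat.cast_div_charZero (Nat.dvd_of_mem_divisors hd), inv_div]

theorem sigmaRatio_eq_prod {n : ℕ} (hn : n ≠ 0) :
    sigmaRatio n =
      ∏ p ∈ n.primeFactors, ∑ i ∈ range (n.factorization p + 1), ((p : ℝ)⁻¹) ^ i := by
  have h1 := ArithmeticFunction.isMultiplicative_sigma (k := 1) |>.multiplicative_factorization _ hn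
  have h2 := Nat.prod_factorization_pow_eq_self hn
  rw [Finsupp.prod, Nat.support_factorization] at h1 h2
  have h3 : (n : ℝ) = ∏ p ∈ n.primeFactors, (p : ℝ) ^ n.factorization p := by
    conv_lhs => rw [← h2]
    push_cast; rfl
  rw [sigmaRatio, h1, Nat.cast_prod]
  conv_lhs => rw [h3]
  rw [← prod_div_distrib]
  refine prod_congr rfl fun p hp => ?_
  have hp' := Nat.prime_of_mem_primeFactors hp
  have hp0 : (p : ℝ) ≠ 0 := by exact_mod_cast hp'.ne_zero
  rw [ArithmeticFunction.sigma_one_apply_prime_pow hp', Nat.cast_sum, sum_div,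
    ← sum_range_reflect]
  refine sum_congr rfl fun i hi => ?_
  have hi' : i ≤ n.factorization p := by rw [mem_range] at hi; omega
  have : n.factorization p + 1 - 1 - i = n.factorization p - i := by omega
  rw [this, inv_pow, Nat.cast_pow, div_eq_iff (pow_ne_zero _ hp0), inv_mul_eq_div,
    eq_div_iff (pow_ne_zero _ hp0), ← pow_add, Nat.sub_add_cancel hi']

theorem sigmaRatio_prime_mul {p m : ℕ} (hp : p.Prime) (hpm : ¬ p ∣ m) :
    sigmaRatio (p * m) = (1 + (p : ℝ)⁻¹) * sigmaRatio m := by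
  have hp0 : (p : ℝ) ≠ 0 := by exact_mod_cast hp.ne_zero
  have h := (ArithmeticFunction.isMultiplicative_sigma (k := 1)).map_mul_of_coprime
    ((hp.coprime_iff_not_dvd).2 hpm)
  have h2 : ArithmeticFunction.sigma 1 p = 1 + p := by
    rw [ArithmeticFunction.sigma_one_apply, hp.sum_divisors]; ring
  rw [sigmaRatio, h, h2, sigmaRatio]
  push_cast
  rw [mul_div_mul_comm]
  congr 1
  field_simp
  ring

theorem totientRatio_prime_mul {p m : ℕ} (hp : p.Prime) (hpm : ¬ p ∣ m) :
    totientRatio (p * m) = (1 - (p : ℝ)⁻¹)⁻¹ * totientRatio m := by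
  have hp0 : (p : ℝ) ≠ 0 := by exact_mod_cast hp.ne_zero
  rw [totientRatio, Nat.totient_mul ((hp.coprime_iff_not_dvd).2 hpm), Nat.totient_prime hp,
    totientRatio, Nat.cast_mul, Nat.cast_mul, mul_div_mul_comm, Nat.cast_sub hp.one_le]
  congr 1
  rw [Nat.cast_one]
  have : (1 - (p : ℝ)⁻¹) = (p - 1) / p := by field_simp
  rw [this, inv_div]

theorem exists_tendsto_propGE_sigmaRatio (t : ℝ) :
    ∃ l, Tendsto (fun N : ℕ => propGE sigmaRatio t N) atTop (𝓝 l) := by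
  refine exists_tendsto_propGE (g := fun d => (d : ℝ)⁻¹) (c := fun p => 1 + (p : ℝ)⁻¹)
    (fun d => by positivity) (by simp) ?_ (fun n _ => sigmaRatio_eq_sum n)
    (fun p m hp _ h => sigmaRatio_prime_mul hp h) ?_ t
  · refine (Real.summable_nat_pow_inv.2 one_lt_two).congr fun d => ?_
    rw [div_eq_mul_inv, sq, mul_inv]
  · intro p _ q _ h
    simpa using h

/-- The function `μ²(d) / φ(d)`, written as a product over the primes dividing `d`. -/
noncomputable def sqfreeInvTotient (d : ℕ) : ℝ :=
  if Squarefree d then ∏ p ∈ d.primeFactors, ((p : ℝ) - 1)⁻¹ else 0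

theorem prime_sub_one_pos {p : ℕ} (hp : p.Prime) : (0 : ℝ) < p - 1 :=
  sub_pos.2 (by exact_mod_cast hp.one_lt)

theorem sqfreeInvTotient_nonneg (d : ℕ) : 0 ≤ sqfreeInvTotient d := by
  rw [sqfreeInvTotient]
  split_ifs
  · exact prod_nonneg fun p hp =>
      (inv_pos.2 (prime_sub_one_pos (Nat.prime_of_mem_primeFactors hp))).le
  · exact le_rfl

theorem totientRatio_eq_sum {n : ℕ} (hn : n ≠ 0) :
    totientRatio n = ∑ d ∈ n.divisors, sqfreeInvTotient d := by
  have h1 : ∑ d ∈ n.divisors, sqfreeInvTotient d =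
      ∑ d ∈ n.divisors with Squarefree d, ∏ p ∈ d.primeFactors, ((p : ℝ) - 1)⁻¹ := by
    rw [sum_filter]; rfl
  rw [h1, Nat.sum_divisors_filter_squarefree hn, Nat.factors_eq, totientRatio_eq_prod hn]
  have h2 : (n.primeFactorsList : Multiset ℕ).toFinset = n.primeFactors := rfl
  have h3 : ∀ p ∈ n.primeFactors, (1 - (p : ℝ)⁻¹)⁻¹ = 1 + ((p : ℝ) - 1)⁻¹ := fun p hp => by
    have hp' := Nat.prime_of_mem_primeFactors hp
    have h0 := prime_sub_one_pos hp'
    have hp0 : (p : ℝ) ≠ 0 := by exact_mod_cast hp'.ne_zero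
    have : (1 - (p : ℝ)⁻¹) = (p - 1) / p := by field_simp
    rw [this, inv_div]
    field_simp
    ring
  rw [prod_congr rfl h3, prod_one_add, h2]
  refine sum_congr rfl fun s hs => ?_
  have : (s.val.prod).primeFactors = s := by
    rw [prod_val]
    exact Nat.primeFactors_prod fun p hp => Nat.prime_of_mem_primeFactors (mem_powerset.1 hs hp)
  rw [this]

/-- For squarefree `d` with set of prime divisors `s`, this is `d ≤ 2 φ(d)²`. -/
theorem le_two_mul_prod_sub_one_sq {s : Finset ℕ} (hs : ∀ p ∈ s, p.Prime) :
    ∏ p ∈ s, (p : ℝ) ≤ 2 * (∏ p ∈ s, ((p : ℝ) - 1)) ^ 2 := by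
  have h1 : ∏ p ∈ s, (p : ℝ) * (if p = 2 then (1 / 2 : ℝ) else 1) ≤ ∏ p ∈ s, ((p : ℝ) - 1) ^ 2 := by
    refine prod_le_prod (fun p _ => by positivity) fun p hp => ?_
    split_ifs with h
    · subst h; norm_num
    · have : (3 : ℝ) ≤ p := by
        have := (hs p hp).two_le
        exact_mod_cast (show 3 ≤ p by omega)
      nlinarith
  have h2 : (1 / 2 : ℝ) ≤ ∏ p ∈ s, (if p = 2 then (1 / 2 : ℝ) else 1) := by
    rw [prod_ite_eq']
    split_ifs <;> norm_num
  rw [prod_mul_distrib, prod_pow] at h1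
  have h3 : (0 : ℝ) ≤ ∏ p ∈ s, (p : ℝ) := prod_nonneg fun p _ => by positivity
  nlinarith

theorem summable_sqfreeInvTotient_div : Summable fun d : ℕ => sqfreeInvTotient d / d := by
  have hs : Summable fun d : ℕ => √2 * ((d : ℝ) ^ (3 / 2 : ℝ))⁻¹ :=
    (Real.summable_nat_rpow_inv.2 (by norm_num)).mul_left _
  refine hs.of_nonneg_of_le
    (fun d => div_nonneg (sqfreeInvTotient_nonneg d) (Nat.cast_nonneg d)) fun d => ?_
  rw [sqfreeInvTotient]
  split_ifs with hd
  · have hd0 : (0 : ℝ) < d := by exact_mod_cast Nat.pos_of_ne_zero hd.ne_zero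
    have hpr : ∀ p ∈ d.primeFactors, p.Prime := fun p hp => Nat.prime_of_mem_primeFactors hp
    have h := le_two_mul_prod_sub_one_sq hpr
    have h' : ∏ p ∈ d.primeFactors, (p : ℝ) = d := by
      rw [← Nat.cast_prod, Nat.prod_primeFactors_of_squarefree hd]
    rw [h'] at h
    have hP : 0 < ∏ p ∈ d.primeFactors, ((p : ℝ) - 1) :=
      prod_pos fun p hp => prime_sub_one_pos (hpr p hp)
    have h2 : √d ≤ √2 * ∏ p ∈ d.primeFactors, ((p : ℝ) - 1) := by
      rw [← Real.sqrt_sq hP.le, ← Real.sqrt_mul (by norm_num)]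
      exact Real.sqrt_le_sqrt h
    have h3 : (d : ℝ) ^ (3 / 2 : ℝ) = d * √d := by
      rw [Real.sqrt_eq_rpow, show (3 / 2 : ℝ) = 1 + 1 / 2 by norm_num, Real.rpow_add hd0,
        Real.rpow_one]
    have hsd : 0 < √(d : ℝ) := Real.sqrt_pos.2 hd0
    rw [h3, prod_inv_distrib, ← div_eq_mul_inv, inv_eq_one_div, div_div,
      div_le_div_iff₀ (by positivity) (by positivity)]
    nlinarith
  · rw [zero_div]; positivity

theorem exists_tendsto_propGE_totientRatio (t : ℝ) :
    ∃ l, Tendsto (fun N : ℕ => propGE totientRatio t N) atTop (𝓝 l) := by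
  refine exists_tendsto_propGE (g := sqfreeInvTotient) (c := fun p => (1 - (p : ℝ)⁻¹)⁻¹)
    sqfreeInvTotient_nonneg (by simp [sqfreeInvTotient]) summable_sqfreeInvTotient_div
    (fun n hn => totientRatio_eq_sum hn.ne')
    (fun p m hp _ h => totientRatio_prime_mul hp h) ?_ t
  intro p _ q _ h
  simpa using h

theorem tendsto_propGE_sigmaRatio (t : ℝ) :
    Tendsto (fun N : ℕ => propGE sigmaRatio t N) atTop (𝓝 (distA t)) :=
  tendsto_nhds_limUnder (exists_tendsto_propGE_sigmaRatio t)

theorem tendsto_propGE_totientRatio (t : ℝ) :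
    Tendsto (fun N : ℕ => propGE totientRatio t N) atTop (𝓝 (distB t)) :=
  tendsto_nhds_limUnder (exists_tendsto_propGE_totientRatio t)

/-! ### Comparing `σ(Qn)/(Qn)` with `n/φ(n)` -/

theorem geom_sum_eq_mul_inv {x : ℝ} (hx : x < 1) (k : ℕ) :
    ∑ i ∈ range k, x ^ i = (1 - x ^ k) * (1 - x)⁻¹ := by
  rw [← mul_neg_geom_sum, mul_comm, ← mul_assoc, inv_mul_cancel₀ (by linarith), one_mul]

theorem inv_prime_mem_Ioo {p : ℕ} (hp : p.Prime) : (p : ℝ)⁻¹ ∈ Set.Ioo (0 : ℝ) 1 := by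
  have : (1 : ℝ) < p := by exact_mod_cast hp.one_lt
  exact ⟨by positivity, inv_lt_one_of_one_lt₀ this⟩

theorem sigmaRatio_le_totientRatio {n : ℕ} (hn : n ≠ 0) : sigmaRatio n ≤ totientRatio n := by
  rw [sigmaRatio_eq_prod hn, totientRatio_eq_prod hn]
  refine prod_le_prod (fun p _ => sum_nonneg fun i _ => by positivity) fun p hp => ?_
  obtain ⟨h0, h1⟩ := inv_prime_mem_Ioo (Nat.prime_of_mem_primeFactors hp)
  rw [geom_sum_eq_mul_inv h1]
  exact mul_le_of_le_one_left (inv_nonneg.2 (by linarith))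
    (by linarith [pow_pos h0 (n.factorization p + 1)])

/-- Weierstrass's product inequality. -/
theorem one_sub_sum_le_prod {s : Finset ℕ} {x : ℕ → ℝ} (h0 : ∀ i ∈ s, 0 ≤ x i)
    (h1 : ∀ i ∈ s, x i ≤ 1) : 1 - ∑ i ∈ s, x i ≤ ∏ i ∈ s, (1 - x i) := by
  induction s using Finset.induction_on with
  | empty => simp
  | insert a s ha ih =>
    rw [sum_insert ha, prod_insert ha]
    have ih := ih (fun i hi => h0 i (mem_insert_of_mem hi)) fun i hi => h1 i (mem_insert_of_mem hi)
    have hs : 0 ≤ ∑ i ∈ s, x i := sum_nonneg fun i hi => h0 i (mem_insert_of_mem hi)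
    have ha0 := h0 a (mem_insert_self a s)
    have ha1 := h1 a (mem_insert_self a s)
    nlinarith

/-- If every prime `p ∣ n` occurs in the multiple `m` of `n` to a power at least `e p`, then
`σ(m)/m` falls short of `n/φ(n)` by at most the relative error `∑_{p ∣ n} p^{-(e p + 1)}`: compare
Euler factors at `p ∣ n`, and bound below by `1` the factors of `σ(m)/m` at the other primes. -/
theorem totientRatio_mul_le_sigmaRatio {n m : ℕ} (hm : m ≠ 0) (hnm : n ∣ m) (e : ℕ → ℕ)
    (he : ∀ p ∈ n.primeFactors, p ^ e p ∣ m) :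
    totientRatio n * (1 - ∑ p ∈ n.primeFactors, ((p : ℝ)⁻¹) ^ (e p + 1)) ≤ sigmaRatio m := by
  have hn : n ≠ 0 := ne_zero_of_dvd_ne_zero hm hnm
  have hpos : ∀ p ∈ n.primeFactors, (p : ℝ)⁻¹ ∈ Set.Ioo (0 : ℝ) 1 := fun p hp =>
    inv_prime_mem_Ioo (Nat.prime_of_mem_primeFactors hp)
  have hge1 : ∀ (p k : ℕ), 1 ≤ ∑ i ∈ range (k + 1), ((p : ℝ)⁻¹) ^ i := fun p k => by
    rw [sum_range_succ', pow_zero]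
    exact le_add_of_nonneg_left (sum_nonneg fun i _ => by positivity)
  calc totientRatio n * (1 - ∑ p ∈ n.primeFactors, ((p : ℝ)⁻¹) ^ (e p + 1))
      ≤ totientRatio n * ∏ p ∈ n.primeFactors, (1 - ((p : ℝ)⁻¹) ^ (e p + 1)) := by
        refine mul_le_mul_of_nonneg_left (one_sub_sum_le_prod (fun p hp => ?_) fun p hp => ?_)
          (div_nonneg (Nat.cast_nonneg _) (Nat.cast_nonneg _))
        · exact (pow_pos (hpos p hp).1 _).le
        · exact pow_le_one₀ (hpos p hp).1.le (hpos p hp).2.le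
    _ = ∏ p ∈ n.primeFactors, ∑ i ∈ range (e p + 1), ((p : ℝ)⁻¹) ^ i := by
        rw [totientRatio_eq_prod hn, mul_comm, ← prod_mul_distrib]
        exact prod_congr rfl fun p hp => (geom_sum_eq_mul_inv (hpos p hp).2 _).symm
    _ ≤ ∏ p ∈ n.primeFactors, ∑ i ∈ range (m.factorization p + 1), ((p : ℝ)⁻¹) ^ i := by
        refine prod_le_prod (fun p _ => sum_nonneg fun i _ => by positivity) fun p hp => ?_
        refine sum_le_sum_of_subset_of_nonneg (range_subset_range.2 ?_) fun i _ _ => by positivity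
        have := ((Nat.prime_of_mem_primeFactors hp).pow_dvd_iff_le_factorization hm).1 (he p hp)
        omega
    _ ≤ sigmaRatio m := by
        rw [sigmaRatio_eq_prod hm, ← prod_sdiff (Nat.primeFactors_mono hnm hm)]
        refine le_mul_of_one_le_left (prod_nonneg fun p _ => sum_nonneg fun i _ => by positivity) ?_
        exact Finset.one_le_prod fun p _ => hge1 p _

/-! ### Chebyshev bound for the tail of `∑ 1/p²` -/

/-- Abel summation of `∑ log p / p²` against Chebyshev's bound `θ(x) ≤ x log 4`, as an induction
on the upper end `N`; the term in `θ(N)` is the boundary term. -/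
theorem sum_prime_log_div_sq_le {w : ℕ} (N : ℕ) (hN : w ≤ N) :
    ∑ p ∈ (Ioc w N).filter Nat.Prime, Real.log p / (p : ℝ) ^ 2 ≤
      Chebyshev.theta N / ((N : ℝ) + 1) ^ 2 +
        2 * Real.log 4 * (((w : ℝ) + 1)⁻¹ - ((N : ℝ) + 1)⁻¹) := by
  induction N, hN using Nat.le_induction with
  | base =>
    simp only [Ioc_self, filter_empty, sum_empty, sub_self, mul_zero, add_zero]
    exact div_nonneg (Chebyshev.theta_nonneg _) (by positivity)
  | succ N hN ih =>
    have hθ : Chebyshev.theta ((N + 1 : ℕ) : ℝ) = Chebyshev.theta N +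
        if (N + 1).Prime then Real.log ((N + 1 : ℕ) : ℝ) else 0 := by
      rw [Chebyshev.theta_eq_sum_Icc, Chebyshev.theta_eq_sum_Icc, Nat.floor_natCast,
        Nat.floor_natCast, sum_filter, sum_filter, sum_Icc_succ_top (by omega)]
    have hsum : ∑ p ∈ (Ioc w (N + 1)).filter Nat.Prime, Real.log p / (p : ℝ) ^ 2 =
        ∑ p ∈ (Ioc w N).filter Nat.Prime, Real.log p / (p : ℝ) ^ 2 +
        (if (N + 1).Prime then Real.log ((N + 1 : ℕ) : ℝ) else 0) / ((N : ℝ) + 1) ^ 2 := by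
      rw [sum_filter, sum_filter, sum_Ioc_succ_top hN]
      split_ifs <;> simp
    have hle := Chebyshev.theta_le_log4_mul_x (x := ((N + 1 : ℕ) : ℝ)) (by positivity)
    have h4 : 0 ≤ Real.log 4 := Real.log_nonneg (by norm_num)
    set a : ℝ := (N : ℝ) + 1 with ha
    have ha0 : 0 < a := by positivity
    have hcast : ((N + 1 : ℕ) : ℝ) = a := by push_cast; rfl
    rw [hcast] at hθ hsum hle ⊢
    set Θ := Chebyshev.theta a
    have key : Θ * (1 / a ^ 2 - 1 / (a + 1) ^ 2) ≤ 2 * Real.log 4 * (a⁻¹ - (a + 1)⁻¹) := by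
      have e1 : 1 / a ^ 2 - 1 / (a + 1) ^ 2 = (2 * a + 1) / (a ^ 2 * (a + 1) ^ 2) := by
        field_simp; ring
      have e2 : a⁻¹ - (a + 1)⁻¹ = 1 / (a * (a + 1)) := by field_simp; ring
      rw [e1, e2]
      calc Θ * ((2 * a + 1) / (a ^ 2 * (a + 1) ^ 2))
          ≤ (Real.log 4 * a) * ((2 * a + 1) / (a ^ 2 * (a + 1) ^ 2)) := by gcongr
        _ ≤ (Real.log 4 * a) * ((2 * (a + 1)) / (a ^ 2 * (a + 1) ^ 2)) := by gcongr; linarith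
        _ = _ := by field_simp
    rw [hsum]
    have e3 : Chebyshev.theta (N : ℝ) / a ^ 2 +
        (if (N + 1).Prime then Real.log a else 0) / a ^ 2 = Θ * (1 / a ^ 2) := by
      rw [hθ]; ring
    have e4 : Θ / (a + 1) ^ 2 = Θ * (1 / (a + 1) ^ 2) := by ring
    rw [e4]
    linarith

/-- The factor `1 / log w`, saved over summing `1/n²` over all integers `n > w`, is what brings the
relative error down to the order `1 / (√y log y)`. -/
theorem sum_prime_inv_sq_le {w : ℕ} (hw : 2 ≤ w) {s : Finset ℕ}
    (hs : ∀ p ∈ s, p.Prime ∧ w < p) :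
    ∑ p ∈ s, ((p : ℝ)⁻¹) ^ 2 ≤ 2 * Real.log 4 / (w * Real.log w) := by
  set N := w + s.sup id
  have hsub : s ⊆ (Ioc w N).filter Nat.Prime := fun p hp => mem_filter.2
    ⟨mem_Ioc.2 ⟨(hs p hp).2, (le_sup (f := id) hp).trans (Nat.le_add_left _ _)⟩, (hs p hp).1⟩
  have hw' : (2 : ℝ) ≤ w := by exact_mod_cast hw
  have hl : 0 < Real.log w := Real.log_pos (by linarith)
  have h4 : 0 ≤ Real.log 4 := Real.log_nonneg (by norm_num)
  have h1 : ∑ p ∈ s, ((p : ℝ)⁻¹) ^ 2 * Real.log w ≤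
      ∑ p ∈ (Ioc w N).filter Nat.Prime, Real.log p / (p : ℝ) ^ 2 := by
    refine (sum_le_sum fun p hp => ?_).trans (sum_le_sum_of_subset_of_nonneg hsub fun p _ _ => ?_)
    · have : Real.log w ≤ Real.log p :=
        Real.log_le_log (by linarith) (by exact_mod_cast (hs p hp).2.le)
      rw [inv_pow, inv_mul_eq_div]
      gcongr
    · exact div_nonneg (Real.log_natCast_nonneg p) (by positivity)
  have h2 := sum_prime_log_div_sq_le N (Nat.le_add_right w _)
  have h3 : Chebyshev.theta N / ((N : ℝ) + 1) ^ 2 ≤ 2 * Real.log 4 * ((N : ℝ) + 1)⁻¹ := by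
    have := Chebyshev.theta_le_log4_mul_x (x := N) (by positivity)
    rw [div_le_iff₀ (by positivity)]
    have e : 2 * Real.log 4 * ((N : ℝ) + 1)⁻¹ * ((N : ℝ) + 1) ^ 2 = 2 * Real.log 4 * (N + 1) := by
      field_simp
    rw [e]
    nlinarith [(Nat.cast_nonneg N : (0 : ℝ) ≤ N)]
  have h5 : ((w : ℝ) + 1)⁻¹ ≤ (w : ℝ)⁻¹ := by gcongr; linarith
  rw [← sum_mul] at h1
  rw [← div_div, le_div_iff₀ hl, div_eq_mul_inv]
  nlinarith

/-! ### The multiplier `Q` -/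

/-- With the multiplier `Q = w# · (v#)^K`, where `v ≤ w`, the power to which a prime divisor `p` of
`n` is certain to divide `Q * n`; for `p ≤ v` one factor that `n` contributes is not counted. -/
def guaranteedExponent (v w K p : ℕ) : ℕ := if p ≤ v then K + 1 else if p ≤ w then 2 else 1

theorem pow_guaranteedExponent_dvd {v w K n p : ℕ} (hvw : v ≤ w) (hp : p ∈ n.primeFactors) :
    p ^ guaranteedExponent v w K p ∣ primorial w * primorial v ^ K * n := by
  have hpp := Nat.prime_of_mem_primeFactors hp
  have hpn := Nat.dvd_of_mem_primeFactors hp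
  rw [guaranteedExponent]
  split_ifs with h1 h2
  · rw [pow_succ']
    exact (mul_dvd_mul (hpp.dvd_primorial_iff.2 (h1.trans hvw))
      (pow_dvd_pow_of_dvd (hpp.dvd_primorial_iff.2 h1) K)).mul_right n
  · rw [sq]
    exact mul_dvd_mul ((hpp.dvd_primorial_iff.2 h2).mul_right _) hpn
  · rw [pow_one]
    exact hpn.mul_left _

theorem sum_inv_pow_guaranteedExponent_le {v w K : ℕ} (hv : 0 < v) (hw : 2 ≤ w) {s : Finset ℕ}
    (hs : ∀ p ∈ s, p.Prime) :
    ∑ p ∈ s, ((p : ℝ)⁻¹) ^ (guaranteedExponent v w K p + 1) ≤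
      v * ((2 : ℝ) ^ K)⁻¹ + ((v : ℝ) ^ 2)⁻¹ + 2 * Real.log 4 / (w * Real.log w) := by
  have hv' : (0 : ℝ) < v := by exact_mod_cast hv
  rw [← sum_filter_add_sum_filter_not s (· ≤ v),
    ← sum_filter_add_sum_filter_not (s.filter fun p => ¬ p ≤ v) (· ≤ w), ← add_assoc]
  refine add_le_add (add_le_add ?_ ?_) ?_
  · have hcard : ((s.filter (· ≤ v)).card : ℝ) ≤ v := by
      have : s.filter (· ≤ v) ⊆ Icc 1 v := fun p hp =>
        mem_Icc.2 ⟨(hs p (mem_filter.1 hp).1).one_le, (mem_filter.1 hp).2⟩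
      have := card_le_card this
      rw [Nat.card_Icc, Nat.add_sub_cancel] at this
      exact_mod_cast this
    calc _ ≤ ∑ p ∈ s.filter (· ≤ v), ((2 : ℝ) ^ K)⁻¹ := sum_le_sum fun p hp => by
          obtain ⟨hp, hpv⟩ := mem_filter.1 hp
          have h2 : (2 : ℝ) ≤ p := by exact_mod_cast (hs p hp).two_le
          rw [guaranteedExponent, if_pos hpv, inv_pow]
          gcongr
          calc (2 : ℝ) ^ K ≤ p ^ K := by gcongr
            _ ≤ p ^ (K + 1 + 1) := pow_le_pow_right₀ (by linarith) (by omega)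
      _ ≤ _ := by
          rw [sum_const, nsmul_eq_mul]
          gcongr
  · calc _ ≤ ∑ p ∈ (s.filter fun p => ¬ p ≤ v).filter (· ≤ w),
          (v : ℝ)⁻¹ * ((p : ℝ) ^ 2)⁻¹ := sum_le_sum fun p hp => by
          simp only [mem_filter, not_le] at hp
          have : (v : ℝ) ≤ p := by exact_mod_cast hp.1.2.le
          rw [guaranteedExponent, if_neg (by omega), if_pos hp.2, inv_pow, pow_succ' _ 2, mul_inv]
          gcongr
      _ ≤ (v : ℝ)⁻¹ * (v : ℝ)⁻¹ := by
          rw [← mul_sum]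
          gcongr
          refine sum_inv_sq_le hv fun p hp => ?_
          simp only [mem_filter, not_le] at hp
          exact hp.1.2
      _ = _ := by rw [sq, mul_inv]
  · refine le_trans (sum_le_sum fun p hp => ?_) (sum_prime_inv_sq_le (w := w) hw
      (s := (s.filter fun p => ¬ p ≤ v).filter (fun p => ¬ p ≤ w)) fun p hp => ?_)
    · simp only [mem_filter, not_le] at hp
      rw [guaranteedExponent, if_neg (by omega), if_neg (by omega)]
    · simp only [mem_filter, not_le] at hp
      exact ⟨hs p hp.1.1, hp.2⟩

theorem eventually_pow_le_two_pow : ∀ᶠ m : ℕ in atTop, m ^ 6 ≤ 2 ^ (m / 40) := by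
  have h := (tendsto_pow_const_div_const_pow_of_one_lt 6 (r := (2 : ℝ)) one_lt_two).comp
    (tendsto_add_atTop_nat 1)
  have h' := (h.eventually_le_const (u := 1 / (2 * 40 ^ 6)) (by norm_num))
  filter_upwards [(Nat.tendsto_div_const_atTop (show 40 ≠ 0 by norm_num)).eventually h'] with m hm
  simp only [Function.comp_apply] at hm
  rw [div_le_iff₀ (by positivity), pow_succ (2 : ℝ)] at hm
  have hlt : (m : ℝ) ≤ 40 * ((m / 40 + 1 : ℕ) : ℝ) := by
    exact_mod_cast (show m ≤ 40 * (m / 40 + 1) by omega)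
  have : (m : ℝ) ^ 6 ≤ (2 : ℝ) ^ (m / 40) := by
    calc (m : ℝ) ^ 6 ≤ (40 * ((m / 40 + 1 : ℕ) : ℝ)) ^ 6 := by gcongr
      _ ≤ _ := by rw [mul_pow]; linarith
  exact_mod_cast this

/-- For `z = √y` large, `Q = w# · (v#)^K` with `w = m³`, `v = m²`, `K = ⌊m/40⌋` and
`m = ⌊(2z)^{1/3}⌋` loses little and is small. Since `w ≈ 2z`, `log Q ≤ (41/40) w log 4 < 3z`. The
relative error is dominated by the primes above `w`, which give at most `2 log 4 / (w log w)`; as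
`log 4 < 5/2`, this is less than `5 / (2 z log z)` with room to spare. -/
theorem eventually_exists_multiplier : ∀ᶠ z : ℝ in atTop, ∃ Q : ℕ, 0 < Q ∧
    (Q : ℝ) < Real.exp (3 * z) ∧ ∀ n : ℕ, 0 < n →
      totientRatio n * (1 - 5 / (2 * z * Real.log z)) ≤ sigmaRatio (Q * n) := by
  have hfloor : Tendsto (fun z : ℝ => ⌊(2 * z) ^ (1 / 3 : ℝ)⌋₊) atTop atTop :=
    tendsto_nat_floor_atTop.comp ((tendsto_rpow_atTop (by norm_num)).comp
      (tendsto_id.const_mul_atTop two_pos))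
  have hlog : ∀ᶠ m : ℕ in atTop, Real.log m ≤ 1 / 5 * m := by
    filter_upwards [tendsto_natCast_atTop_atTop.eventually
      (Real.isLittleO_log_id_atTop.bound (show (0 : ℝ) < 1 / 5 by norm_num))] with m hm
    simpa using (le_abs_self _).trans hm
  filter_upwards [hfloor.eventually (eventually_pow_le_two_pow.and
    (hlog.and (eventually_ge_atTop 20))), eventually_ge_atTop 2] with z hz hz2
  set m := ⌊(2 * z) ^ (1 / 3 : ℝ)⌋₊ with hm
  obtain ⟨hK, hlogm, hm20⟩ := hz
  have hm20' : (20 : ℝ) ≤ m := by exact_mod_cast hm20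
  have hcube : ((2 * z) ^ (1 / 3 : ℝ)) ^ 3 = 2 * z := by
    rw [← Real.rpow_natCast, ← Real.rpow_mul (by linarith)]
    norm_num
  have hlow : (m : ℝ) ^ 3 ≤ 2 * z := by
    rw [← hcube]
    gcongr
    exact Nat.floor_le (by positivity)
  have hup : 2 * z ≤ 1.2 * (m : ℝ) ^ 3 := by
    calc 2 * z ≤ ((m : ℝ) + 1) ^ 3 := by
          rw [← hcube]
          gcongr
          exact (Nat.lt_floor_add_one _).le
      _ ≤ (1.05 * (m : ℝ)) ^ 3 := by gcongr; linarith
      _ ≤ _ := by rw [mul_pow]; gcongr; norm_num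
  have hm0 : (0 : ℝ) < m := by linarith
  have h4 : Real.log 4 < 1.3863 := by
    rw [show (4 : ℝ) = 2 ^ 2 by norm_num, Real.log_pow]
    have := Real.log_two_lt_d9
    push_cast
    linarith
  have h40 : 0 < Real.log 4 := Real.log_pos (by norm_num)
  refine ⟨primorial (m ^ 3) * primorial (m ^ 2) ^ (m / 40),
    Nat.mul_pos (primorial_pos _) (pow_pos (primorial_pos _) _), ?_, fun n hn => ?_⟩
  · have hQ : primorial (m ^ 3) * primorial (m ^ 2) ^ (m / 40) ≤ 4 ^ (m ^ 3 + m ^ 2 * (m / 40)) := by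
      rw [pow_add, pow_mul]
      exact Nat.mul_le_mul (primorial_le_four_pow _)
        (Nat.pow_le_pow_left (primorial_le_four_pow _) _)
    have hQ' : ((primorial (m ^ 3) * primorial (m ^ 2) ^ (m / 40) : ℕ) : ℝ) ≤
        Real.exp (Real.log 4 * ((m : ℝ) ^ 3 + m ^ 2 * ((m / 40 : ℕ) : ℝ))) := by
      calc _ ≤ ((4 ^ (m ^ 3 + m ^ 2 * (m / 40)) : ℕ) : ℝ) := by exact_mod_cast hQ
        _ = Real.exp (Real.log 4) ^ (m ^ 3 + m ^ 2 * (m / 40)) := by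
            rw [Real.exp_log (by norm_num)]; push_cast; rfl
        _ = _ := by
            rw [← Real.exp_nat_mul]
            push_cast
            rw [mul_comm]
    refine hQ'.trans_lt (Real.exp_lt_exp.2 ?_)
    have hdiv : ((m / 40 : ℕ) : ℝ) ≤ m / 40 := by
      have := Nat.cast_div_le (α := ℝ) (m := m) (n := 40)
      exact_mod_cast this
    have hm3 : (0 : ℝ) < (m : ℝ) ^ 3 := by positivity
    have : (m : ℝ) ^ 3 + m ^ 2 * ((m / 40 : ℕ) : ℝ) ≤ 41 / 40 * (m : ℝ) ^ 3 := by
      have : (m : ℝ) ^ 2 * ((m / 40 : ℕ) : ℝ) ≤ m ^ 2 * (m / 40) := by gcongr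
      nlinarith
    calc Real.log 4 * ((m : ℝ) ^ 3 + m ^ 2 * ((m / 40 : ℕ) : ℝ))
        ≤ 1.3863 * (41 / 40 * (m : ℝ) ^ 3) := by gcongr
      _ < 3 * z := by linarith
  · have hne : primorial (m ^ 3) * primorial (m ^ 2) ^ (m / 40) * n ≠ 0 :=
      (Nat.mul_pos (Nat.mul_pos (primorial_pos _) (pow_pos (primorial_pos _) _)) hn).ne'
    have hvw : m ^ 2 ≤ m ^ 3 := Nat.pow_le_pow_right (by omega) (by norm_num)
    refine le_trans (mul_le_mul_of_nonneg_left ?_ (div_nonneg (Nat.cast_nonneg _)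
      (Nat.cast_nonneg _))) (totientRatio_mul_le_sigmaRatio hne (Nat.dvd_mul_left _ _)
        (guaranteedExponent (m ^ 2) (m ^ 3) (m / 40))
        fun p hp => pow_guaranteedExponent_dvd hvw hp)
    have hsum := sum_inv_pow_guaranteedExponent_le (v := m ^ 2) (w := m ^ 3) (K := m / 40)
      (by positivity) (by nlinarith [Nat.pow_le_pow_left hm20 3])
      (s := n.primeFactors) fun p hp => Nat.prime_of_mem_primeFactors hp
    refine sub_le_sub_left (hsum.trans ?_) 1
    set l := Real.log m with hl
    have hl0 : 0 < l := Real.log_pos (by linarith)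
    have hlogz : Real.log z ≤ 3 * l := by
      have : z ≤ (m : ℝ) ^ 3 := by nlinarith [pow_pos hm0 3]
      calc Real.log z ≤ Real.log ((m : ℝ) ^ 3) := Real.log_le_log (by linarith) this
        _ = 3 * l := by rw [Real.log_pow]; push_cast; rfl
    have hz0 : 0 < Real.log z := Real.log_pos (by linarith)
    have hden : 2 * z * Real.log z ≤ 3.6 * ((m : ℝ) ^ 3 * l) := by
      calc 2 * z * Real.log z ≤ (1.2 * (m : ℝ) ^ 3) * (3 * l) := by gcongr
        _ = _ := by ring
    have hK' : ((2 : ℝ) ^ (m / 40))⁻¹ ≤ ((m : ℝ) ^ 6)⁻¹ := by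
      gcongr
      exact_mod_cast hK
    have hlogw : Real.log ((m ^ 3 : ℕ) : ℝ) = 3 * l := by
      push_cast
      rw [Real.log_pow]; push_cast; rfl
    rw [hlogw]
    push_cast
    calc (m : ℝ) ^ 2 * ((2 : ℝ) ^ (m / 40))⁻¹ + (((m : ℝ) ^ 2) ^ 2)⁻¹ +
          2 * Real.log 4 / ((m : ℝ) ^ 3 * (3 * l))
        ≤ (m : ℝ) ^ 2 * ((m : ℝ) ^ 6)⁻¹ + (((m : ℝ) ^ 2) ^ 2)⁻¹ +
          2 * 1.3863 / ((m : ℝ) ^ 3 * (3 * l)) := by gcongr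
      _ = (2 * l / m + 2 * 1.3863 / 3) / ((m : ℝ) ^ 3 * l) := by field_simp; ring
      _ ≤ (2 / 5 + 2 * 1.3863 / 3) / ((m : ℝ) ^ 3 * l) := by
          have : 2 * l / m ≤ 2 / 5 := by
            rw [div_le_iff₀ hm0]
            linarith
          gcongr
      _ ≤ 5 / (3.6 * ((m : ℝ) ^ 3 * l)) := by
          rw [← div_div 5]
          exact div_le_div_of_nonneg_right (by norm_num) (by positivity)
      _ ≤ _ := by gcongr

/-! ### Transfer to densities -/

/-- Multiplication by `Q` embeds `{n ≤ N : f n ≥ s}` into `{n ≤ QN : h n ≥ t}`. -/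
theorem propGE_div_le {f h : ℕ → ℝ} {s t : ℝ} {Q : ℕ} (hQ : 0 < Q)
    (H : ∀ n, 0 < n → s ≤ f n → t ≤ h (Q * n)) (N : ℕ) :
    propGE f s N / Q ≤ propGE h t (Q * N) := by
  have hcard : ((Icc 1 N).filter (fun n => s ≤ f n)).card ≤
      ((Icc 1 (Q * N)).filter (fun n => t ≤ h n)).card := by
    refine card_le_card_of_injOn (Q * ·) (fun n hn => ?_) fun a _ b _ hab =>
      Nat.eq_of_mul_eq_mul_left hQ hab
    obtain ⟨hn, hs⟩ := mem_filter.1 (mem_coe.1 hn)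
    rw [mem_Icc] at hn
    exact mem_coe.2 (mem_filter.2 ⟨mem_Icc.2 ⟨Nat.mul_pos hQ hn.1, Nat.mul_le_mul_left Q hn.2⟩,
      H n hn.1 hs⟩)
  rw [propGE, propGE, div_div, Nat.cast_mul, mul_comm (N : ℝ)]
  gcongr

theorem div_le_of_tendsto_propGE {f h : ℕ → ℝ} {s t a b : ℝ} {Q : ℕ} (hQ : 0 < Q)
    (H : ∀ n, 0 < n → s ≤ f n → t ≤ h (Q * n))
    (ha : Tendsto (fun N : ℕ => propGE f s N) atTop (𝓝 a))
    (hb : Tendsto (fun N : ℕ => propGE h t N) atTop (𝓝 b)) : a / Q ≤ b :=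
  le_of_tendsto_of_tendsto' (ha.div_const _)
    (hb.comp (tendsto_id.const_mul_atTop' hQ)) fun N => propGE_div_le hQ H N

/-- The ratio `σ(n)/n` is unbounded: at `M!` it is at least the `M`-th harmonic number. -/
theorem exists_le_sigmaRatio (t : ℝ) : ∃ n, 0 < n ∧ t ≤ sigmaRatio n := by
  obtain ⟨M, hM⟩ := (Real.tendsto_sum_range_one_div_nat_succ_atTop.eventually_ge_atTop t).exists
  refine ⟨M.factorial, M.factorial_pos, hM.trans ?_⟩
  rw [sigmaRatio_eq_sum]
  calc ∑ i ∈ range M, 1 / ((i : ℝ) + 1) = ∑ d ∈ (range M).map (addRightEmbedding 1), (d : ℝ)⁻¹ := by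
        rw [sum_map]
        refine sum_congr rfl fun i _ => ?_
        simp
    _ ≤ _ := by
        refine sum_le_sum_of_subset_of_nonneg (fun d hd => ?_) fun _ _ _ => by positivity
        obtain ⟨i, hi, rfl⟩ := mem_map.1 hd
        rw [mem_range] at hi
        exact Nat.mem_divisors.2 ⟨Nat.dvd_factorial (by simp) (by simpa using hi),
          M.factorial_ne_zero⟩

theorem sigmaRatio_le_of_dvd {m n : ℕ} (hn : n ≠ 0) (h : m ∣ n) :
    sigmaRatio m ≤ sigmaRatio n := by
  rw [sigmaRatio_eq_sum, sigmaRatio_eq_sum]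
  exact sum_le_sum_of_subset_of_nonneg (Nat.divisors_subset_of_dvd hn h) fun _ _ _ => by positivity

/-- All multiples of a single `n` with `σ(n)/n ≥ t` are counted. This positivity makes the
inequality in `eventually_distB_lt` strict. -/
theorem distA_pos (t : ℝ) : 0 < distA t := by
  obtain ⟨n, hn, ht⟩ := exists_le_sigmaRatio t
  have hone : Tendsto (fun N : ℕ => propGE (fun _ => (0 : ℝ)) 0 N) atTop (𝓝 1) := by
    refine tendsto_const_nhds.congr' ?_
    filter_upwards [eventually_gt_atTop 0] with N hN
    have : (N : ℝ) ≠ 0 := by exact_mod_cast hN.ne'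
    simp [propGE, this]
  refine lt_of_lt_of_le (by positivity) (div_le_of_tendsto_propGE hn (fun k hk _ => ?_) hone
    (tendsto_propGE_sigmaRatio t))
  exact ht.trans (sigmaRatio_le_of_dvd (Nat.mul_pos hn hk).ne' (Nat.dvd_mul_right _ _))

theorem distA_le_distB (t : ℝ) : distA t ≤ distB t := by
  have := div_le_of_tendsto_propGE one_pos (fun n hn (h : t ≤ sigmaRatio n) => ?_)
    (tendsto_propGE_sigmaRatio t) (tendsto_propGE_totientRatio t)
  · simpa using this
  · rw [one_mul]
    exact h.trans (sigmaRatio_le_totientRatio hn.ne')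

theorem eventually_distB_lt : ∀ᶠ t : ℝ in atTop, distB t <
    Real.exp (3 * √(yParam t)) *
      distA (t - 5 * Real.exp Real.eulerMascheroniConstant / √(yParam t)) := by
  set γ := Real.eulerMascheroniConstant
  have hz : ∀ t, √(yParam t) = Real.exp (t * Real.exp (-γ) / 2) := fun t => by
    rw [yParam, ← Real.exp_half]
  have hlim : Tendsto (fun t : ℝ => √(yParam t)) atTop atTop := by
    simp_rw [hz]
    exact Real.tendsto_exp_atTop.comp
      ((tendsto_id.atTop_mul_const (Real.exp_pos _)).atTop_div_const two_pos)
  filter_upwards [hlim.eventually eventually_exists_multiplier,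
    hlim.eventually (eventually_ge_atTop 5),
    (Real.tendsto_log_atTop.comp hlim).eventually (eventually_ge_atTop 1)] with t hQ h5 hlog
  rw [Function.comp_apply] at hlog
  set z := √(yParam t) with hzdef
  obtain ⟨Q, hQ0, hQlt, hQ⟩ := hQ
  -- this is where a relative error `5 / (2 z log z)` becomes the absolute error `5 e^γ / z`
  have ht : t = 2 * Real.exp γ * Real.log z := by
    rw [hzdef, hz, Real.log_exp, Real.exp_neg]
    field_simp
  have hz0 : 0 < z := by linarith
  have hle : distB t / Q ≤ distA (t - 5 * Real.exp γ / z) := by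
    refine div_le_of_tendsto_propGE hQ0 (fun n hn h => ?_) (tendsto_propGE_totientRatio t)
      (tendsto_propGE_sigmaRatio _)
    refine le_trans ?_ (hQ n hn)
    have hfac : 0 ≤ 1 - 5 / (2 * z * Real.log z) := by
      rw [sub_nonneg, div_le_one (by positivity)]
      nlinarith
    refine le_trans (le_of_eq ?_) (mul_le_mul_of_nonneg_right h hfac)
    have : t * (5 / (2 * z * Real.log z)) = 5 * Real.exp γ / z := by
      rw [ht]
      have : Real.log z ≠ 0 := by linarith
      field_simp
    rw [mul_sub, this, mul_one]
  rw [div_le_iff₀ (by exact_mod_cast hQ0), mul_comm] at hle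
  exact hle.trans_lt (mul_lt_mul_of_pos_right hQlt (distA_pos _))
end

theorem theorem3 :
    (∀ t : ℝ,
      Filter.Tendsto (fun N : ℕ => propGE sigmaRatio t N) Filter.atTop (nhds (distA t)) ∧
      Filter.Tendsto (fun N : ℕ => propGE totientRatio t N) Filter.atTop (nhds (distB t))) ∧
    ∃ t₀ : ℝ, ∀ t : ℝ, t₀ ≤ t →
      distA t ≤ distB t ∧
      distB t <
        Real.exp (3 * Real.sqrt (yParam t)) *
          distA (t - 5 * Real.exp Real.eulerMascheroniConstant / Real.sqrt (yParam t)) := by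
  obtain ⟨t₀, h⟩ := Filter.eventually_atTop.1 eventually_distB_lt
  exact ⟨fun t => ⟨tendsto_propGE_sigmaRatio t, tendsto_propGE_totientRatio t⟩,
    t₀, fun t ht => ⟨distA_le_distB t, h t ht⟩⟩
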